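/- Let $\log$ denote the logarithm to base $2$. For $k\ge 1$ let $\mathcal M_k$ be the class of monotonic distributions $\theta=(\theta_1,\dots,\theta_k)$ on $\{1,\dots,k\}$, i.e. $\theta_1\ge\theta_2\ge\dots\ge\theta_k\ge 0$ and $\sum_i\theta_i=1$, and for $x^n=(x_1,\dots,x_n)\in\{1,\dots,k\}^n$ put $P_\theta(x^n)=\prod_{t=1}^n\theta_{x_t}$. A code is a length function $L:\{1,\dots,k\}^n\to\mathbb R$ (integer length constraints being ignored) with $\sum_{x^n}2^{-L(x^n)}\le 1$. The $n$th-order individual minimax redundancy of $\mathcal M_k$ with respect to the monotonic maximum-likelihood description length $-\log\sup_{\theta\in\mathcal M_k}P_\theta(x^n)$ is $$\hat R_n^+(\mathcal M_k)=\inf_L\ \sup_{\theta\in\mathcal M_k}\ \max_{x^n}\ \frac1n\left\{L(x^n)+\log P_\theta(x^n)\right\}\qquad(\log 0=-\infty).$$ Then, as $n\to\infty$, $$\hat R_n^+(\mathcal M_k)\ \ge\ \begin{cases} \dfrac{k-1}{2n}\log\dfrac{n}{k^3}+\dfrac kn\log\dfrac{e^{23/12}}{\sqrt{2\pi}}-O\!\left(\dfrac{\log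 k}{n}\right), & 2\le k\le \dfrac{e^{5/18}}{(2\pi)^{1/3}}\,n^{1/3},\\[2ex] \dfrac{e^{5/18}}{(2\pi)^{1/3}}\cdot\dfrac32(\log e)\cdot\dfrac{n^{1/3}}{n}-O\!\left(\dfrac{\log n}{n}\right), & n>k>\dfrac{e^{5/18}}{(2\pi)^{1/3}}\,n^{1/3},\\[2ex] \dfrac32(\log e)\cdot\dfrac{n^{1/3}}{n}-O\!\left(\dfrac{\log n}{n}\right), & k\ge n, \end{cases}$$ where the $O(\cdot)$ terms are uniform in $k$: there are absolute constants $C>0$ and $n_0$ such that for all $n\ge n_0$ and all $k$ in the respective range the bounds hold with $O(g)$ replaced by $C\,g$. -/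

import Mathlib

noncomputable section

namespace MonotonicRedundancy

/-- The class of monotonic distributions over an alphabet with `k` letters: nonnegative vectors
`θ` summing to one, with `θ 0 ≥ θ 1 ≥ … ≥ θ (k - 1)`. The letter `j : Fin k` stands for the
positive integer `j + 1`. -/
def monotonicClass (k : ℕ) : Set (Fin k → ℝ) :=
  {θ | (∀ j, 0 ≤ θ j) ∧ ∑ j, θ j = 1 ∧ Antitone θ}

/-- The probability of the sequence `x` of length `n` under the i.i.d. source with letter
probabilities `θ`. -/
def seqProb {n k : ℕ} (θ : Fin k → ℝ) (x : Fin n → Fin k) : ℝ :=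
  ∏ t, θ (x t)

/-- Length functions, in bits, of codes for the sequences of length `n` over `k` letters, with
integer length constraints ignored: `2 ^ (-L x)` is a (sub)probability assignment, which is the
Kraft inequality. An infinite length, that is, an assigned probability zero, is left out: every
sequence has positive probability under some monotonic distribution, so such a code would have
infinite redundancy. -/
def IsCodeLength {n k : ℕ} (L : (Fin n → Fin k) → ℝ) : Prop :=
  ∑ x, (2 : ℝ) ^ (-L x) ≤ 1

/-- The logarithm to the base 2 of a nonnegative real, with `log 0 = -∞`. -/
def elog (p : ℝ) : EReal :=
  if p = 0 then ⊥ else ((Real.logb 2 p : ℝ) : EReal)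

/-- The `n`-th order individual minimax redundancy (bits per symbol) of a class `Λ` of
distributions over `k` letters: the best code for the worst source in `Λ` and the worst sequence.
The supremum over `θ ∈ Λ` of `log P_θ(x)` is minus the ML description length of `x` in `Λ`. -/
def individualMinimaxRedundancy (n : ℕ) {k : ℕ} (Λ : Set (Fin k → ℝ)) : EReal :=
  ⨅ L ∈ {L : (Fin n → Fin k) → ℝ | IsCodeLength L}, ⨆ θ ∈ Λ, ⨆ x : Fin n → Fin k,
    ((1 / (n : ℝ) : ℝ) : EReal) * ((L x : EReal) + elog (seqProb θ x))

/-- The constant `e ^ (5/18) / (2 π) ^ (1/3)`. -/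
def cThreshold : ℝ :=
  Real.exp (5 / 18) / (2 * Real.pi) ^ (1 / 3 : ℝ)

end MonotonicRedundancy

end

noncomputable section

namespace MonotonicRedundancy

open Finset

/-! ### Redundancy from below by maximum likelihood mass; change of alphabet. -/

section Code

variable {n k : ℕ}

/-! By Shtarkov's argument, `n` times the redundancy is at least the log of the maximum likelihood
mass of any set of sequences. Take the sequences with decreasing letter counts: their empirical
distributions are monotonic, and relabelling letters shows that they carry at least a `1 / k!` share
of the i.i.d. Shtarkov sum.

That sum runs over count vectors. Up to a common factor each term is a product of `c ^ c * e ^ (-c)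
/ c!`, and each such factor dominates `1 / √2` times the coefficient of `X ^ c` in `(1 - X) ^
(-1/2)`. The coefficients convolve to that of `X ^ n` in `(1 - X) ^ (-k/2)`, a Gamma quotient.
Stirling-type bounds then give `le_individualMinimaxRedundancy_monotonicClass`.

Larger alphabets contain smaller ones, so for large `k` only about `n ^ (1/3)` letters are used;
then `log n ≥ 3 log j` cancels the logarithmic terms and `3/2 * j` remains. -/

lemma elog_of_pos {p : ℝ} (hp : 0 < p) : elog p = ((Real.logb 2 p : ℝ) : EReal) := by
  rw [elog, if_neg hp.ne']

/-- A Shtarkov-type bound: the total maximum likelihood mass of any set of sequences bounds the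
individual redundancy from below. -/
lemma logb_div_le_individualMinimaxRedundancy (hn : 0 < n) (Λ : Set (Fin k → ℝ))
    (A : Finset (Fin n → Fin k)) (θ : (Fin n → Fin k) → Fin k → ℝ) (hθ : ∀ x ∈ A, θ x ∈ Λ)
    (hpos : ∀ x ∈ A, 0 < seqProb (θ x) x) {S : ℝ} (hS : 0 < S)
    (h : S ≤ ∑ x ∈ A, seqProb (θ x) x) :
    ((Real.logb 2 S / n : ℝ) : EReal) ≤ individualMinimaxRedundancy n Λ := by
  refine le_iInf₂ fun L hL => ?_
  -- Otherwise summing over `A` and applying Kraft would make the mass less than `S`.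
  obtain ⟨x, hxA, hx⟩ : ∃ x ∈ A, S * (2 : ℝ) ^ (-L x) ≤ seqProb (θ x) x := by
    by_contra! hcon
    have hne : A.Nonempty := by
      rw [nonempty_iff_ne_empty]
      rintro rfl
      simp at h
      linarith
    have h1 : ∑ x ∈ A, seqProb (θ x) x < ∑ x ∈ A, S * (2 : ℝ) ^ (-L x) :=
      sum_lt_sum_of_nonempty hne hcon
    have h2 : ∑ x ∈ A, (2 : ℝ) ^ (-L x) ≤ 1 :=
      (sum_le_univ_sum_of_nonneg fun x => by positivity).trans hL
    rw [← mul_sum] at h1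
    nlinarith
  refine le_iSup₂_of_le (θ x) (hθ x hxA) (le_iSup_of_le x ?_)
  rw [elog_of_pos (hpos x hxA), ← EReal.coe_add, ← EReal.coe_mul, EReal.coe_le_coe_iff]
  have h3 := Real.logb_le_logb_of_le one_lt_two (by positivity) hx
  rw [Real.logb_mul hS.ne' (by positivity), Real.logb_rpow (by norm_num) (by norm_num)] at h3
  rw [div_eq_inv_mul, one_div]
  gcongr
  linarith

/-- Extension of a distribution on `j` letters to a larger alphabet by zeros. -/
def extendZero {j : ℕ} (k : ℕ) (θ : Fin j → ℝ) : Fin k → ℝ :=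
  fun i => if h : (i : ℕ) < j then θ ⟨i, h⟩ else 0

lemma extendZero_castLE {j : ℕ} (h : j ≤ k) (θ : Fin j → ℝ) (i : Fin j) :
    extendZero k θ (Fin.castLE h i) = θ i := by
  simp [extendZero]

lemma extendZero_mem_monotonicClass {j : ℕ} (h : j ≤ k) {θ : Fin j → ℝ}
    (hθ : θ ∈ monotonicClass j) : extendZero k θ ∈ monotonicClass k := by
  obtain ⟨h0, h1, h2⟩ := hθ
  refine ⟨fun i => ?_, ?_, fun a b hab => ?_⟩
  · unfold extendZero
    split_ifs
    exacts [h0 _, le_rfl]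
  · rw [← h1, ← sum_subset (subset_univ (univ.map (Fin.castLEEmb h)))]
    · simp [extendZero_castLE h]
    · intro i _ hi
      rw [extendZero, dif_neg]
      intro hij
      exact hi (mem_map.2 ⟨⟨i, hij⟩, mem_univ _, by simp⟩)
  · have hab' : (a : ℕ) ≤ b := hab
    unfold extendZero
    split_ifs with hb ha
    · exact h2 hab'
    · omega
    · exact h0 _
    · exact le_rfl

/-- A code for `k` letters restricts to the sequences over the first `j`, and sources extend by
zeros. This leaves the number of letters free to be optimized. -/
lemma individualMinimaxRedundancy_monotonicClass_mono {j : ℕ} (h : j ≤ k) :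
    individualMinimaxRedundancy n (monotonicClass j) ≤
      individualMinimaxRedundancy n (monotonicClass k) := by
  refine le_iInf₂ fun L hL => ?_
  refine iInf₂_le_of_le (fun x : Fin n → Fin j => L fun t => Fin.castLE h (x t)) ?_ ?_
  · let e : (Fin n → Fin j) ↪ (Fin n → Fin k) :=
      ⟨fun x t => Fin.castLE h (x t), fun x y hxy => funext fun t =>
        Fin.castLE_injective h (congrFun hxy t)⟩
    have h1 : ∑ x : Fin n → Fin j, (2 : ℝ) ^ (-L (e x)) =
        ∑ y ∈ univ.map e, (2 : ℝ) ^ (-L y) := by rw [sum_map]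
    have h2 : ∑ y ∈ univ.map e, (2 : ℝ) ^ (-L y) ≤ ∑ y, (2 : ℝ) ^ (-L y) :=
      sum_le_univ_sum_of_nonneg fun x => by positivity
    exact (h1.trans_le h2).trans hL
  · refine iSup₂_le fun θ hθ => iSup_le fun x => ?_
    refine le_iSup₂_of_le (extendZero k θ) (extendZero_mem_monotonicClass h hθ)
      (le_iSup_of_le (fun t => Fin.castLE h (x t)) ?_)
    simp [seqProb, extendZero_castLE h]

end Code

/-! ### Letter counts, sorting by relabelling, sums over types. -/

section Counts

variable {n k : ℕ}

/-- The number of occurrences of the letter `i` in `x`. -/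
def letterCount (x : Fin n → Fin k) (i : Fin k) : ℕ := #{t | x t = i}

/-- The empirical distribution of `x`. -/
def empirical (x : Fin n → Fin k) (i : Fin k) : ℝ := letterCount x i / n

lemma sum_letterCount (x : Fin n → Fin k) : ∑ i, letterCount x i = n := by
  simpa [letterCount] using (card_eq_sum_card_fiberwise (f := x) (s := univ) (t := univ)
    (fun _ _ => mem_coe.2 (mem_univ _))).symm

lemma empirical_mem_monotonicClass (hn : 0 < n) {x : Fin n → Fin k}
    (hx : Antitone (letterCount x)) : empirical x ∈ monotonicClass k := by
  refine ⟨fun i => by unfold empirical; positivity, ?_, fun a b hab => ?_⟩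
  · simp only [empirical]
    rw [← sum_div, ← Nat.cast_sum, sum_letterCount, div_self (by positivity)]
  · unfold empirical
    gcongr
    exact hx hab

lemma seqProb_empirical_pos (x : Fin n → Fin k) : 0 < seqProb (empirical x) x := by
  refine prod_pos fun t _ => ?_
  have h1 : 0 < letterCount x (x t) := card_pos.2 ⟨t, by simp⟩
  have h2 : 0 < n := Fin.pos t
  unfold empirical
  positivity

lemma seqProb_empirical (x : Fin n → Fin k) :
    seqProb (empirical x) x = ∏ i, ((letterCount x i : ℝ) / n) ^ letterCount x i := by
  rw [seqProb, ← prod_fiberwise_of_maps_to (g := x) (t := univ) (fun _ _ => mem_univ _)]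
  refine prod_congr rfl fun i _ => ?_
  rw [prod_congr rfl (g := fun _ => empirical x i)
    (fun t ht => by rw [(mem_filter.1 ht).2]), prod_const]
  rfl

lemma letterCount_perm_comp (σ : Equiv.Perm (Fin k)) (x : Fin n → Fin k) (i : Fin k) :
    letterCount (fun t => σ (x t)) i = letterCount x (σ.symm i) := by
  simp [letterCount, Equiv.eq_symm_apply]

lemma seqProb_empirical_perm_comp (σ : Equiv.Perm (Fin k)) (x : Fin n → Fin k) :
    seqProb (empirical fun t => σ (x t)) (fun t => σ (x t)) = seqProb (empirical x) x := by
  simp [seqProb, empirical, letterCount_perm_comp]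

lemma exists_perm_antitone_letterCount (x : Fin n → Fin k) :
    ∃ σ : Equiv.Perm (Fin k), Antitone (letterCount fun t => σ (x t)) := by
  let f : Fin k → ℕᵒᵈ := fun i => OrderDual.toDual (letterCount x i)
  refine ⟨(Tuple.sort f).symm, fun a b hab => ?_⟩
  rw [letterCount_perm_comp, letterCount_perm_comp]
  exact Tuple.monotone_sort f hab

open Classical in
/-- Sequences with decreasing letter counts carry at least a `1 / k!` fraction of the total maximum
likelihood mass. -/
lemma sum_seqProb_empirical_le (n k : ℕ) :
    ∑ x : Fin n → Fin k, seqProb (empirical x) x ≤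
      (k.factorial : ℝ) * ∑ x : Fin n → Fin k with Antitone (letterCount x), seqProb (empirical x) x := by
  have hnn (x : Fin n → Fin k) : 0 ≤ seqProb (empirical x) x := (seqProb_empirical_pos x).le
  let g : (Fin n → Fin k) → ℝ := fun x =>
    if Antitone (letterCount x) then seqProb (empirical x) x else 0
  have hg (x) : 0 ≤ g x := by
    simp only [g]
    split_ifs
    exacts [hnn x, le_rfl]
  calc ∑ x : Fin n → Fin k, seqProb (empirical x) x
      ≤ ∑ x : Fin n → Fin k, ∑ σ : Equiv.Perm (Fin k), g (fun t => σ (x t)) := by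
        refine sum_le_sum fun x _ => ?_
        obtain ⟨σ, hσ⟩ := exists_perm_antitone_letterCount x
        -- One permutation sorting the counts of `x` already contributes the full mass of `x`.
        refine le_trans ?_ (single_le_sum (fun σ _ => hg _) (mem_univ σ))
        simp only [g]
        rw [if_pos hσ, seqProb_empirical_perm_comp]
    _ = ∑ σ : Equiv.Perm (Fin k), ∑ x : Fin n → Fin k, g (fun t => σ (x t)) := sum_comm
    _ = ∑ σ : Equiv.Perm (Fin k), ∑ x : Fin n → Fin k, g x :=
        -- Relabelling permutes the sequences, so all `k!` inner sums agree.
        sum_congr rfl fun σ _ => Equiv.sum_comp ((Equiv.refl (Fin n)).arrowCongr σ) g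
    _ = _ := by
        simp [g, sum_filter, Fintype.card_perm]

/-- Both sides are the coefficient of `X ^ c` in `(∑ X i) ^ n`, expanded word by word and by the
multinomial theorem. -/
lemma card_letterCount_eq (c : Fin k →₀ ℕ) (hc : ∑ i, c i = n) :
    #{x : Fin n → Fin k | ∀ i, letterCount x i = c i} = Nat.multinomial univ c := by
  have h1 : (∑ i : Fin k, (MvPolynomial.X i : MvPolynomial (Fin k) ℕ)) ^ n =
      ∑ x : Fin n → Fin k, MvPolynomial.monomial
        (Finsupp.equivFunOnFinite.symm (letterCount x)) 1 := by
    calc (∑ i : Fin k, (MvPolynomial.X i : MvPolynomial (Fin k) ℕ)) ^ n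
        = ∏ _t : Fin n, ∑ i : Fin k, (MvPolynomial.X i : MvPolynomial (Fin k) ℕ) := by simp
      _ = _ := by
        rw [prod_univ_sum, Fintype.piFinset_univ]
        refine sum_congr rfl fun x _ => ?_
        simp only [MvPolynomial.X]
        rw [← MvPolynomial.monomial_sum_one]
        refine congrArg (fun m => MvPolynomial.monomial m 1) (Finsupp.ext fun i => ?_)
        simp [letterCount, Finsupp.finsetSum_apply, Finsupp.single_apply]
  have h2 := MvPolynomial.coeff_sum_X_pow_of_fintype (R := ℕ) c n
  rw [h1, Finsupp.sum_fintype _ _ (fun _ => rfl), if_pos hc, MvPolynomial.coeff_sum,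
    Finsupp.multinomial_eq_of_support_subset (subset_univ c.support)] at h2
  simp only [MvPolynomial.coeff_monomial] at h2
  rw [sum_boole] at h2
  simpa [Finsupp.ext_iff] using h2

/-- Summing a function of the letter counts over all sequences. -/
lemma sum_comp_letterCount (G : (Fin k → ℕ) → ℝ) :
    ∑ x : Fin n → Fin k, G (letterCount x) =
      ∑ c ∈ finsuppAntidiag (univ : Finset (Fin k)) n, Nat.multinomial univ c * G c := by
  rw [← sum_fiberwise_of_maps_to (t := finsuppAntidiag univ n)
    (g := fun x => Finsupp.equivFunOnFinite.symm (letterCount x))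
    (fun x _ => by simp [mem_finsuppAntidiag, sum_letterCount])]
  refine sum_congr rfl fun c hc => ?_
  rw [← card_letterCount_eq c (mem_finsuppAntidiag.1 hc).1, ← nsmul_eq_mul, ← sum_const]
  refine sum_congr (by simp [Finsupp.ext_iff]) fun x hx => ?_
  congr 1
  funext i
  exact (mem_filter.1 hx).2 i

end Counts

end MonotonicRedundancy

end

namespace MonotonicRedundancy

open Finset

/-! ### The weights with generating function `(1 - X) ^ (-1/2)`. -/

section Weights

/-- The coefficients of `(1 - X) ^ (-s)`. -/
lemma coeff_binomialSeries_neg (s : ℝ) (n : ℕ) :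
    (-1 : ℝ) ^ n * PowerSeries.coeff n (PowerSeries.binomialSeries ℝ (-s)) =
      Ring.multichoose s n := by
  rw [PowerSeries.binomialSeries_coeff, Ring.choose_neg', ← Int.cast_negOnePow_natCast]
  rw [Units.smul_def, zsmul_eq_mul, smul_eq_mul, mul_one, ← mul_assoc, ← Int.cast_mul]
  simp

lemma multichoose_succ (s : ℝ) (n : ℕ) :
    (n + 1) * Ring.multichoose s (n + 1) = (s + n) * Ring.multichoose s n := by
  have h (m : ℕ) : (m.factorial : ℝ) * Ring.multichoose s m = (ascPochhammer ℝ m).eval s := by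
    rw [← nsmul_eq_mul, Ring.factorial_nsmul_multichoose_eq_ascPochhammer,
      Polynomial.ascPochhammer_smeval_eq_eval]
  have h1 := h (n + 1)
  rw [ascPochhammer_succ_eval, ← h n, Nat.factorial_succ] at h1
  have : (n.factorial : ℝ) ≠ 0 := by positivity
  push_cast at h1
  apply mul_left_cancel₀ this
  linear_combination h1

lemma multichoose_half (n : ℕ) :
    Ring.multichoose (1 / 2 : ℝ) n = n.centralBinom / 4 ^ n := by
  induction n with
  | zero => simp
  | succ n ih =>
    have h1 := multichoose_succ (1 / 2) n
    have h2 : ((n : ℝ) + 1) * (n + 1).centralBinom = 2 * (2 * n + 1) * n.centralBinom := by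
      exact_mod_cast Nat.succ_mul_centralBinom_succ n
    have : ((n : ℝ) + 1) ≠ 0 := by positivity
    rw [ih] at h1
    apply mul_left_cancel₀ this
    rw [h1, pow_succ]
    field_simp
    linear_combination -2 * h2

lemma multichoose_half_nonneg (n : ℕ) : 0 ≤ Ring.multichoose (1 / 2 : ℝ) n := by
  rw [multichoose_half]
  positivity

/-- Compare coefficients of `X ^ n` in the `k`-th power of the series with exponent `-1/2`; the sign
`(-1) ^ n` splits over the parts of `c`. -/
lemma sum_prod_multichoose_half (k n : ℕ) :
    ∑ c ∈ finsuppAntidiag (univ : Finset (Fin k)) n, ∏ i, Ring.multichoose (1 / 2 : ℝ) (c i) =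
      Ring.multichoose (k / 2 : ℝ) n := by
  have hpow : ∀ j : ℕ, (PowerSeries.binomialSeries ℝ (-(1 / 2) : ℝ)) ^ j =
      PowerSeries.binomialSeries ℝ (-(j / 2) : ℝ) := by
    intro j
    induction j with
    | zero => simp
    | succ j ih =>
      rw [pow_succ, ih, ← PowerSeries.binomialSeries_add]
      congr 1
      push_cast
      ring
  rw [← coeff_binomialSeries_neg, ← hpow, ← Fintype.card_fin k, ← card_univ, ← prod_const,
    PowerSeries.coeff_prod, card_univ, Fintype.card_fin, mul_sum]
  refine sum_congr rfl fun c hc => ?_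
  rw [← (mem_finsuppAntidiag.1 hc).1, ← prod_pow_eq_pow_sum, ← prod_mul_distrib]
  simp only [coeff_binomialSeries_neg]

/-- For `m > 0` this is `stirlingSeq (2 * m) ≤ stirlingSeq m` after clearing denominators. The
constant `√2` is asymptotically sharp. -/
lemma multichoose_half_le (m : ℕ) :
    Ring.multichoose (1 / 2 : ℝ) m ≤
      √2 * ((m : ℝ) ^ m * Real.exp (-m) / m.factorial) := by
  rcases Nat.eq_zero_or_pos m with rfl | hm
  · simp
  have hanti : Stirling.stirlingSeq (2 * m) ≤ Stirling.stirlingSeq m := by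
    have := Stirling.stirlingSeq'_antitone (show m - 1 ≤ 2 * m - 1 by omega)
    simpa [Nat.sub_add_cancel hm, Nat.sub_add_cancel (show 1 ≤ 2 * m by omega)] using this
  have hm' : (0 : ℝ) < m := by exact_mod_cast hm
  have hcb : (m.centralBinom : ℝ) * (m.factorial * m.factorial) = (2 * m).factorial := by
    rw [Nat.centralBinom_eq_two_mul_choose]
    have := Nat.choose_mul_factorial_mul_factorial (show m ≤ 2 * m by omega)
    rw [show 2 * m - m = m by omega] at this
    rw [← mul_assoc]
    exact_mod_cast this
  rw [multichoose_half]
  unfold Stirling.stirlingSeq at hanti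
  rw [← hcb] at hanti
  have hf : (0 : ℝ) < m.factorial := by positivity
  have hs : √(2 * ((2 * m : ℕ) : ℝ)) = √2 * √(2 * m) := by
    rw [← Real.sqrt_mul (by norm_num)]
    push_cast
    rfl
  have hp : (((2 * m : ℕ) : ℝ) / Real.exp 1) ^ (2 * m) =
      4 ^ m * ((m / Real.exp 1) ^ m * (m / Real.exp 1) ^ m) := by
    push_cast
    rw [mul_div_assoc, mul_pow, pow_mul, two_mul, pow_add]
    norm_num
  have he : (m : ℝ) ^ m * Real.exp (-m) = (m / Real.exp 1) ^ m := by
    rw [div_pow, ← Real.exp_nat_mul, mul_one, Real.exp_neg]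
    rfl
  rw [hs, hp] at hanti
  rw [he]
  set E : ℝ := (m / Real.exp 1) ^ m with hE
  have hE0 : 0 < E := by positivity
  have hq : 0 < √(2 * (m : ℝ)) := by positivity
  have h2 : 0 < √(2 : ℝ) := by positivity
  have h4 : (0 : ℝ) < 4 ^ m := by positivity
  set c : ℝ := (m.centralBinom : ℝ)
  set F : ℝ := (m.factorial : ℝ)
  set q := √(2 * (m : ℝ))
  rw [div_le_div_iff₀ (by positivity) (by positivity)] at hanti
  rw [div_le_iff₀ h4, mul_div_assoc', div_mul_eq_mul_div, le_div_iff₀ hf]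
  have hpos : 0 < F * q * E := by positivity
  refine le_of_mul_le_mul_right ?_ hpos
  linear_combination hanti

end Weights

/-! ### Gamma at integers and half-integers. -/

section GammaBounds

lemma gamma_eq_multichoose {s : ℝ} (hs : 0 < s) (n : ℕ) :
    Real.Gamma (n + s) = n.factorial * Ring.multichoose s n * Real.Gamma s := by
  induction n with
  | zero => simp
  | succ n ih =>
    have h := multichoose_succ s n
    rw [show ((n + 1 : ℕ) : ℝ) + s = (n + s) + 1 by push_cast; ring,
      Real.Gamma_add_one (by positivity), ih, Nat.factorial_succ]
    push_cast
    linear_combination (-(n.factorial : ℝ) * Real.Gamma s) * h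

/-- Integers and half-integers from `1` on. -/
lemma half_induction {P : ℕ → Prop} (h1 : P 1) (h2 : P 2) (h : ∀ j, 1 ≤ j → P j → P (j + 2)) :
    ∀ j, 1 ≤ j → P j := by
  intro j
  induction j using Nat.strong_induction_on with
  | _ j ih =>
    intro hj
    rcases (show j = 1 ∨ j = 2 ∨ 3 ≤ j by omega) with rfl | rfl | h3
    · exact h1
    · exact h2
    · obtain ⟨i, rfl⟩ : ∃ i, j = i + 2 := ⟨j - 2, by omega⟩
      exact h i (by omega) (ih i (by omega) (by omega))

/-- Raising `j` by 2 multiplies the left side by `n` and the right by `n + (j + 1) / 2`. Only the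
half-integer base case needs log-convexity. -/
lemma rpow_mul_factorial_le_gamma {n : ℕ} (hn : 0 < n) (j : ℕ) (hj : 1 ≤ j) :
    (n : ℝ) ^ (((j : ℝ) - 1) / 2) * n.factorial ≤ Real.Gamma (n + ((j : ℝ) + 1) / 2) := by
  have hn' : (0 : ℝ) < n := by exact_mod_cast hn
  revert j
  refine half_induction ?_ ?_ ?_
  · simp [Real.Gamma_nat_eq_factorial]
  · have hG : 0 < Real.Gamma (n + 1 / 2) := Real.Gamma_pos_of_pos (by positivity)
    have hG' : 0 < Real.Gamma (n + 1 / 2 + 1) := Real.Gamma_pos_of_pos (by positivity)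
    -- `n + 1` is the midpoint of `n + 1/2` and `n + 3/2`.
    have h1 := Real.Gamma_mul_add_mul_le_rpow_Gamma_mul_rpow_Gamma (s := n + 1 / 2)
      (t := n + 1 / 2 + 1) (a := 1 / 2) (b := 1 / 2) (by positivity) (by positivity)
      (by norm_num) (by norm_num) (by norm_num)
    rw [← Real.mul_rpow hG.le hG'.le, show 1 / 2 * ((n : ℝ) + 1 / 2) + 1 / 2 * (n + 1 / 2 + 1) =
      n + 1 by ring, Real.Gamma_nat_eq_factorial, ← Real.sqrt_eq_rpow] at h1
    have h2 := Real.Gamma_add_one (s := (n : ℝ) + 1 / 2) (by positivity)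
    have h3 : (n : ℝ) * (Real.Gamma (n + 1 / 2) * Real.Gamma (n + 1 / 2 + 1)) ≤
        Real.Gamma (n + 1 / 2 + 1) ^ 2 := by
      rw [h2]
      nlinarith [mul_pos hG hG]
    have h4 := Real.sqrt_le_sqrt h3
    rw [Real.sqrt_sq hG'.le, Real.sqrt_mul hn'.le] at h4
    push_cast
    rw [show ((2 : ℝ) - 1) / 2 = 1 / 2 by norm_num, ← Real.sqrt_eq_rpow,
      show (n : ℝ) + (2 + 1) / 2 = n + 1 / 2 + 1 by ring]
    exact (mul_le_mul_of_nonneg_left h1 (Real.sqrt_nonneg _)).trans h4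
  · intro j hj ih
    push_cast
    rw [show ((j : ℝ) + 2 - 1) / 2 = (j - 1) / 2 + 1 by ring, Real.rpow_add_one hn'.ne',
      show (n : ℝ) + (j + 2 + 1) / 2 = n + (j + 1) / 2 + 1 by ring,
      Real.Gamma_add_one (by positivity)]
    have h0 : (0 : ℝ) ≤ (n : ℝ) ^ (((j : ℝ) - 1) / 2) * n.factorial := by positivity
    calc (n : ℝ) ^ (((j : ℝ) - 1) / 2) * n * n.factorial
        = n * ((n : ℝ) ^ (((j : ℝ) - 1) / 2) * n.factorial) := by ring
      _ ≤ (n + (j + 1) / 2) * Real.Gamma (n + ((j : ℝ) + 1) / 2) :=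
        mul_le_mul (le_add_of_nonneg_right (by positivity)) ih h0 (by positivity)

/-- With `x = j / 2`, the step `x → x + 1` reduces to `(x + 1) * log ((x + 1) / x) ≥ 1`; the slack
`2` covers both base cases. -/
lemma log_gamma_half_le (j : ℕ) (hj : 1 ≤ j) :
    Real.log (Real.Gamma ((j : ℝ) / 2)) ≤ j / 2 * Real.log (j / 2) - j / 2 + 2 := by
  revert j
  refine half_induction ?_ ?_ ?_
  · have h1 : Real.log (1 / 2) = -Real.log 2 := by rw [one_div, Real.log_inv]
    have h2 : Real.log Real.pi ≤ Real.log 4 := Real.log_le_log Real.pi_pos Real.pi_le_four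
    have h3 : Real.log 4 = 2 * Real.log 2 := by
      rw [show (4 : ℝ) = 2 ^ 2 by norm_num, Real.log_pow]
      norm_num
    push_cast
    rw [Real.Gamma_one_half_eq, Real.log_sqrt Real.pi_pos.le, h1]
    linarith [Real.log_two_lt_d9]
  · norm_num
  · intro j hj ih
    have hx : (0 : ℝ) < j / 2 := by positivity
    push_cast
    rw [show ((j : ℝ) + 2) / 2 = j / 2 + 1 by ring, Real.Gamma_add_one hx.ne',
      Real.log_mul hx.ne' (Real.Gamma_pos_of_pos hx).ne']
    set x : ℝ := j / 2
    have h1 := Real.one_sub_inv_le_log_of_pos (show 0 < (x + 1) / x by positivity)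
    rw [Real.log_div (by positivity) hx.ne'] at h1
    have h2 : 1 - ((x + 1) / x)⁻¹ = 1 / (x + 1) := by
      field_simp
      ring
    rw [h2, div_le_iff₀ (by positivity)] at h1
    linarith

end GammaBounds

end MonotonicRedundancy

/-! ### Assembling the bound and choosing the number of letters. -/

namespace MonotonicRedundancy

open Finset

lemma multinomial_mul_prod_eq {n k : ℕ} (c : Fin k → ℕ) (hc : ∑ i, c i = n) :
    (Nat.multinomial univ c : ℝ) * ∏ i, ((c i : ℝ) / n) ^ c i =
      (n.factorial * Real.exp n / (n : ℝ) ^ n) *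
        ∏ i, ((c i : ℝ) ^ c i * Real.exp (-(c i)) / (c i).factorial) := by
  have h1 : (∏ i, ((c i).factorial : ℝ)) * Nat.multinomial univ c = n.factorial := by
    have := Nat.multinomial_spec univ c
    rw [hc] at this
    exact_mod_cast this
  have h2 : ∏ i, ((c i).factorial : ℝ) ≠ 0 := prod_ne_zero_iff.2 fun i _ => by positivity
  have h3 : ∏ i, Real.exp (-(c i : ℝ)) = (Real.exp n)⁻¹ := by
    rw [← Real.exp_sum, sum_neg_distrib, ← Nat.cast_sum, hc, Real.exp_neg]
  have h4 : ∏ i, ((c i : ℝ) / n) ^ c i = (∏ i, (c i : ℝ) ^ c i) / (n : ℝ) ^ n := by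
    simp only [div_pow]
    rw [prod_div_distrib, prod_pow_eq_pow_sum, hc]
  rw [prod_div_distrib, prod_mul_distrib, h3, h4, ← h1]
  field_simp

/-- The Shtarkov sum of all memoryless sources over `k` letters. -/
lemma le_sum_seqProb_empirical (n k : ℕ) :
    (n.factorial * Real.exp n / (n : ℝ) ^ n) *
        (((√2) ^ k)⁻¹ * Ring.multichoose (k / 2 : ℝ) n) ≤
      ∑ x : Fin n → Fin k, seqProb (empirical x) x := by
  simp only [seqProb_empirical]
  rw [sum_comp_letterCount (fun c => ∏ i, ((c i : ℝ) / n) ^ c i), ← sum_prod_multichoose_half,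
    mul_sum, mul_sum]
  refine sum_le_sum fun c hc => ?_
  rw [multinomial_mul_prod_eq c (mem_finsuppAntidiag.1 hc).1]
  refine mul_le_mul_of_nonneg_left ?_ (by positivity)
  have h : ∏ i, Ring.multichoose (1 / 2 : ℝ) (c i) ≤
      ∏ i, (√2 * ((c i : ℝ) ^ c i * Real.exp (-(c i)) / (c i).factorial)) :=
    prod_le_prod (fun i _ => multichoose_half_nonneg _) fun i _ => multichoose_half_le _
  rw [prod_mul_distrib, prod_const, card_univ, Fintype.card_fin] at h
  rwa [inv_mul_le_iff₀ (by positivity)]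

lemma log_factorial_le {j : ℕ} (hj : 1 ≤ j) :
    Real.log j.factorial ≤ Real.log j + j * Real.log j - j + 2 := by
  have hj' : (0 : ℝ) < j := by exact_mod_cast hj
  have h := log_gamma_half_le (2 * j) (by omega)
  have h1 : ((2 * j : ℕ) : ℝ) / 2 = j := by
    push_cast
    ring
  rw [h1] at h
  rw [← Real.Gamma_nat_eq_factorial, Real.Gamma_add_one hj'.ne',
    Real.log_mul hj'.ne' (Real.Gamma_pos_of_pos hj').ne']
  linarith

lemma le_log_multichoose {n j : ℕ} (hn : 0 < n) (hj : 2 ≤ j) :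
    (j / 2 - 1) * Real.log n - Real.log (Real.Gamma ((j : ℝ) / 2)) ≤
      Real.log (Ring.multichoose (j / 2 : ℝ) n) ∧ 0 < Ring.multichoose (j / 2 : ℝ) n := by
  have hs : (0 : ℝ) < (j : ℝ) / 2 := by positivity
  have hn' : (0 : ℝ) < n := by exact_mod_cast hn
  have hf : (0 : ℝ) < n.factorial := by positivity
  have hG := Real.Gamma_pos_of_pos hs
  have h1 := gamma_eq_multichoose hs n
  have hG' : 0 < Real.Gamma (n + (j : ℝ) / 2) := Real.Gamma_pos_of_pos (by positivity)
  have hm : 0 < Ring.multichoose (j / 2 : ℝ) n := by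
    rw [h1] at hG'
    exact (pos_iff_pos_of_mul_pos (pos_of_mul_pos_left hG' hG.le)).1 hf
  refine ⟨?_, hm⟩
  -- Index `j - 1` produces `Γ(n + j / 2)` with exponent `j / 2 - 1`.
  have h2 := rpow_mul_factorial_le_gamma hn (j - 1) (by omega)
  rw [Nat.cast_sub (by omega), Nat.cast_one, sub_add_cancel, h1] at h2
  have h3 := Real.log_le_log (by positivity) h2
  rw [Real.log_mul (by positivity) hf.ne', Real.log_mul (by positivity) hG.ne',
    Real.log_mul hf.ne' hm.ne', Real.log_rpow hn'] at h3
  linarith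

lemma le_individualMinimaxRedundancy_monotonicClass {n j k : ℕ} (hn : 0 < n) (hj : 2 ≤ j)
    (hjk : j ≤ k) :
    (((((j : ℝ) - 1) / 2 * Real.log n - 3 / 2 * j * Real.log j + 3 / 2 * j - Real.log j - 4) /
        (Real.log 2 * n) : ℝ) : EReal) ≤
      individualMinimaxRedundancy n (monotonicClass k) := by
  classical
  refine le_trans ?_ (individualMinimaxRedundancy_monotonicClass_mono hjk)
  obtain ⟨hm, hm0⟩ := le_log_multichoose hn hj
  have hn' : (0 : ℝ) < n := by exact_mod_cast hn
  have hj' : (0 : ℝ) < j := by positivity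
  have hjf : (0 : ℝ) < j.factorial := by positivity
  have hf : (0 : ℝ) < n.factorial := by positivity
  have h2 : (0 : ℝ) < (√2 ^ j)⁻¹ := by positivity
  set S : ℝ := (n.factorial * Real.exp n / (n : ℝ) ^ n) *
        (((√2) ^ j)⁻¹ * Ring.multichoose (j / 2 : ℝ) n) / j.factorial with hS
  have hS0 : 0 < S := by positivity
  have hSle : S ≤ ∑ x : Fin n → Fin j with Antitone (letterCount x), seqProb (empirical x) x := by
    rw [hS, div_le_iff₀ hjf, mul_comm _ (j.factorial : ℝ)]
    exact (le_sum_seqProb_empirical n j).trans (sum_seqProb_empirical_le n j)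
  refine le_trans ?_ (logb_div_le_individualMinimaxRedundancy hn _ _ empirical
    (fun x hx => empirical_mem_monotonicClass hn (mem_filter.1 hx).2)
    (fun x _ => seqProb_empirical_pos x) hS0 hSle)
  rw [EReal.coe_le_coe_iff, Real.logb, div_div]
  have hlog2 : 0 < Real.log 2 := Real.log_pos one_lt_two
  refine div_le_div_of_nonneg_right ?_ (by positivity)
  have hlogS : Real.log S = Real.log n.factorial + n - n * Real.log n - j / 2 * Real.log 2 +
      Real.log (Ring.multichoose (j / 2 : ℝ) n) - Real.log j.factorial := by
    rw [hS, Real.log_div (by positivity) hjf.ne', Real.log_mul (by positivity) (by positivity),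
      Real.log_div (by positivity) (by positivity), Real.log_mul hf.ne' (Real.exp_pos _).ne',
      Real.log_exp, Real.log_pow, Real.log_mul h2.ne' hm0.ne', Real.log_inv, Real.log_pow,
      Real.log_sqrt zero_le_two]
    ring
  -- Its term `log n / 2` lifts the coefficient `j / 2 - 1` of `log n` to `(j - 1) / 2`.
  have hst := Stirling.le_log_factorial_stirling hn.ne'
  have hpi : 0 ≤ Real.log (2 * Real.pi) := Real.log_nonneg (by linarith [Real.pi_gt_three])
  have hg := log_gamma_half_le j (by omega)
  -- The `j / 2 * log 2` split off here cancels the loss from `√2 ^ j`.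
  rw [Real.log_div hj'.ne' two_ne_zero] at hg
  have hfj := log_factorial_le (show 1 ≤ j by omega)
  rw [hlogS]
  linarith

/-- `j ^ 3 ≤ n` makes `(j - 1) / 2 * (log n - 3 * log j)` nonnegative. The real `y` absorbs the
rounding of the number of letters. -/
lemma le_individualMinimaxRedundancy_of_cube_le {n j k : ℕ} (hj : 2 ≤ j) (hjk : j ≤ k)
    (hjn : j ^ 3 ≤ n) {y : ℝ} (hy : y ≤ j + 1) :
    ((3 / 2 * Real.logb 2 (Real.exp 1) * (y / n) - 11 * (Real.logb 2 n / n) : ℝ) : EReal) ≤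
      individualMinimaxRedundancy n (monotonicClass k) := by
  have hjn' : 8 ≤ n := (Nat.pow_le_pow_left hj 3).trans hjn
  refine le_trans ?_ (le_individualMinimaxRedundancy_monotonicClass (by omega) hj hjk)
  have hn : (0 : ℝ) < n := by positivity
  have hlog2 : 0 < Real.log 2 := Real.log_pos one_lt_two
  have hj' : (2 : ℝ) ≤ j := by exact_mod_cast hj
  have h1 : 3 * Real.log j ≤ Real.log n := by
    have : Real.log ((j : ℝ) ^ 3) ≤ Real.log n :=
      Real.log_le_log (by positivity) (by exact_mod_cast hjn)
    simpa [Real.log_pow] using this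
  have h2 : Real.log 2 ≤ Real.log j := Real.log_le_log two_pos hj'
  have h3 := mul_le_mul_of_nonneg_left h1 (show 0 ≤ ((j : ℝ) - 1) / 2 by linarith)
  rw [EReal.coe_le_coe_iff, Real.logb, Real.logb, Real.log_exp, le_div_iff₀ (by positivity)]
  have h4 : (3 / 2 * (1 / Real.log 2) * (y / n) - 11 * (Real.log n / Real.log 2 / n)) *
      (Real.log 2 * n) = 3 / 2 * y - 11 * Real.log n := by
    field_simp
  rw [h4]
  linarith [Real.log_two_gt_d9]

lemma half_le_cThreshold : 1 / 2 ≤ cThreshold := by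
  have h1 : (2 * Real.pi) ^ (1 / 3 : ℝ) ≤ 2 := by
    calc (2 * Real.pi) ^ (1 / 3 : ℝ) ≤ (2 ^ (3 : ℝ)) ^ (1 / 3 : ℝ) := by
          refine Real.rpow_le_rpow (by positivity) ?_ (by norm_num)
          norm_num
          linarith [Real.pi_le_four]
      _ = 2 := by rw [← Real.rpow_mul (by norm_num)]; norm_num
  have h2 : 1 ≤ Real.exp (5 / 18) := Real.one_le_exp (by norm_num)
  rw [cThreshold, div_le_div_iff₀ two_pos (Real.rpow_pos_of_pos (by positivity) _)]
  linarith

/-- Equivalent both to `23/12 - log (2π) / 2 ≤ 3/2`, used for small alphabets, and to `cThreshold ≤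
1`. -/
lemma five_sixths_le_log_two_pi : 5 / 6 ≤ Real.log (2 * Real.pi) := by
  rw [Real.le_log_iff_exp_le (by positivity)]
  have : Real.exp (5 / 6) ≤ Real.exp 1 := Real.exp_le_exp.2 (by norm_num)
  linarith [Real.exp_one_lt_d9, Real.pi_gt_three]

lemma cThreshold_le_one : cThreshold ≤ 1 := by
  have h : Real.exp (5 / 18) = Real.exp (5 / 6) ^ (1 / 3 : ℝ) := by
    rw [← Real.exp_mul]
    norm_num
  rw [cThreshold, div_le_one (Real.rpow_pos_of_pos (by positivity) _), h]
  exact Real.rpow_le_rpow (Real.exp_pos _).le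
    ((Real.le_log_iff_exp_le (by positivity)).1 five_sixths_le_log_two_pi) (by norm_num)

/-- The bound with `j = ⌊c n ^ (1/3)⌋` letters in use. -/
lemma le_individualMinimaxRedundancy_of_floor {n k : ℕ} (hn : 1000 ≤ n) {c : ℝ}
    (hc : 1 / 2 ≤ c) (hc1 : c ≤ 1) (hk : ⌊c * (n : ℝ) ^ (1 / 3 : ℝ)⌋₊ ≤ k) :
    ((3 / 2 * Real.logb 2 (Real.exp 1) * (c * (n : ℝ) ^ (1 / 3 : ℝ) / n) -
        11 * (Real.logb 2 n / n) : ℝ) : EReal) ≤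
      individualMinimaxRedundancy n (monotonicClass k) := by
  set y : ℝ := (n : ℝ) ^ (1 / 3 : ℝ) with hy
  have hy3 : y ^ 3 = n := by
    rw [hy, ← Real.rpow_natCast, ← Real.rpow_mul (by positivity)]
    norm_num
  have hy0 : 0 ≤ y := by positivity
  have hn' : (1000 : ℝ) ≤ n := by exact_mod_cast hn
  have hy10 : 10 ≤ y := by
    by_contra! h
    have := pow_lt_pow_left₀ h hy0 (show 3 ≠ 0 by norm_num)
    linarith
  refine le_individualMinimaxRedundancy_of_cube_le ?_ hk ?_ (Nat.lt_floor_add_one _).le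
  -- Here `n ≥ 1000` gives `c * y ≥ 5`, so at least two letters are in use.
  · refine Nat.le_floor ?_
    push_cast
    nlinarith
  · have h1 : (⌊c * y⌋₊ : ℝ) ≤ y :=
      (Nat.floor_le (by positivity)).trans (mul_le_of_le_one_left hy0 hc1)
    have h2 := pow_le_pow_left₀ (by positivity) h1 3
    rw [hy3] at h2
    exact_mod_cast h2

end MonotonicRedundancy

theorem theorem3 :
    ∃ C : ℝ, 0 < C ∧ ∃ n₀ : ℕ, ∀ n : ℕ, n₀ ≤ n → ∀ k : ℕ,
      -- small alphabets
      (2 ≤ k → (k : ℝ) ≤ MonotonicRedundancy.cThreshold * (n : ℝ) ^ (1 / 3 : ℝ) →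
        ((((k : ℝ) - 1) / (2 * n) * Real.logb 2 ((n : ℝ) / (k : ℝ) ^ 3)
            + (k : ℝ) / n * Real.logb 2 (Real.exp (23 / 12) / Real.sqrt (2 * Real.pi))
            - C * (Real.logb 2 k / n) : ℝ) : EReal)
          ≤ MonotonicRedundancy.individualMinimaxRedundancy n
              (MonotonicRedundancy.monotonicClass k)) ∧
      -- intermediate alphabets
      (k < n → MonotonicRedundancy.cThreshold * (n : ℝ) ^ (1 / 3 : ℝ) < (k : ℝ) →
        ((MonotonicRedundancy.cThreshold * (3 / 2 * Real.logb 2 (Real.exp 1))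
              * ((n : ℝ) ^ (1 / 3 : ℝ) / n)
            - C * (Real.logb 2 n / n) : ℝ) : EReal)
          ≤ MonotonicRedundancy.individualMinimaxRedundancy n
              (MonotonicRedundancy.monotonicClass k)) ∧
      -- large alphabets
      (n ≤ k →
        ((3 / 2 * Real.logb 2 (Real.exp 1) * ((n : ℝ) ^ (1 / 3 : ℝ) / n)
            - C * (Real.logb 2 n / n) : ℝ) : EReal)
          ≤ MonotonicRedundancy.individualMinimaxRedundancy n
              (MonotonicRedundancy.monotonicClass k)) := by
  open MonotonicRedundancy in
  -- `11` is not optimized: it absorbs the additive constants, using `k ≥ 2` or the size of `n`.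
  refine ⟨11, by norm_num, 1000, fun n hn k => ⟨fun hk _ => ?_, fun _ hk => ?_, fun hk => ?_⟩⟩
  · refine le_trans ?_ (le_individualMinimaxRedundancy_monotonicClass (by omega) hk le_rfl)
    have hn' : (0 : ℝ) < n := by positivity
    have hk' : (2 : ℝ) ≤ k := by exact_mod_cast hk
    have hlog2 : 0 < Real.log 2 := Real.log_pos one_lt_two
    have h2 : Real.log 2 ≤ Real.log k := Real.log_le_log two_pos hk'
    have hl1 : Real.log ((n : ℝ) / (k : ℝ) ^ 3) = Real.log n - 3 * Real.log k := by
      rw [Real.log_div hn'.ne' (by positivity), Real.log_pow]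
      norm_num
    have hl2 : Real.log (Real.exp (23 / 12) / Real.sqrt (2 * Real.pi)) =
        23 / 12 - Real.log (2 * Real.pi) / 2 := by
      rw [Real.log_div (Real.exp_pos _).ne' (by positivity), Real.log_exp,
        Real.log_sqrt (by positivity)]
    rw [EReal.coe_le_coe_iff, Real.logb, Real.logb, Real.logb, hl1, hl2,
      le_div_iff₀ (by positivity)]
    have h4 : (((k : ℝ) - 1) / (2 * n) * ((Real.log n - 3 * Real.log k) / Real.log 2) +
        k / n * ((23 / 12 - Real.log (2 * Real.pi) / 2) / Real.log 2) -
        11 * (Real.log k / Real.log 2 / n)) * (Real.log 2 * n) =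
        ((k : ℝ) - 1) / 2 * (Real.log n - 3 * Real.log k) +
        k * (23 / 12 - Real.log (2 * Real.pi) / 2) - 11 * Real.log k := by
      field_simp
    rw [h4]
    have h5 := mul_le_mul_of_nonneg_left five_sixths_le_log_two_pi (show (0 : ℝ) ≤ k by linarith)
    linarith [Real.log_two_gt_d9]
  · have h := le_individualMinimaxRedundancy_of_floor hn half_le_cThreshold cThreshold_le_one
      (Nat.floor_le_of_le hk.le)
    convert h using 3
    ring
  · have hn1 : (1 : ℝ) ≤ n := by exact_mod_cast (show 1 ≤ n by omega)
    have hfl : ⌊(1 : ℝ) * (n : ℝ) ^ (1 / 3 : ℝ)⌋₊ ≤ k := by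
      refine Nat.floor_le_of_le ?_
      rw [one_mul]
      exact (Real.rpow_le_self_of_one_le hn1 (by norm_num)).trans (by exact_mod_cast hk)
    simpa using le_individualMinimaxRedundancy_of_floor hn (by norm_num) le_rfl hfl
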